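/- Let $\Omega$ and $\Delta$ be locally compact Hausdorff spaces, let $E$ be a full Hilbert $C_0(\Omega)$-module and $F$ a full Hilbert $C_0(\Delta)$-module (full: the linear span of the inner products is dense in the algebra). For $\omega\in\Omega$ let $\Xi^E_\omega = E/\{e\in E : \langle e,e\rangle(\omega)=0\}$ be the fibre of $E$ at $\omega$, a Hilbert space under $\langle e(\omega),g(\omega)\rangle=\langle e,g\rangle(\omega)$, where $e(\omega)$ denotes the class of $e$; put $\operatorname{supp}_\Omega e=\overline{\{\omega\in\Omega : e(\omega)\neq 0\}}$. Use the same notation for $F$ over $\Delta$, and let $\Xi^F=\bigsqcup_{\nu\in\Delta}\Xi^F_\nu$ carry the bundle topology, generated by the sets $\{\xi\in\Xi^F_\nu : \nu\in U,\ \|\xi-f(\nu)\|<\varepsilon\}$ with $U\subseteq\Delta$ open, $f\in F$ and $\varepsilon>0$. Let $\theta:E\to F$ be a $\mathbb{C}$-linear bijection (not assumed bounded) such that 1. $\theta$ and $\theta^{-1}$ are orthogonality preserving: for $e,g\in E$, $\langle e,g\rangle=0$ implies $\langle\theta(e),\theta(g)\rangle=0$, and for $f,h\in F$, $\langle f,h\rangle=0$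 implies $\langle\theta^{-1}(f),\theta^{-1}(h)\rangle=0$; 2. $\theta$ and $\theta^{-1}$ are quasi-local: $\operatorname{supp}_\Omega\theta^{-1}(\theta(e)\lambda)\subseteq\operatorname{supp}_\Omega e$ for all $e\in E$, $\lambda\in C_0(\Delta)$, and $\operatorname{supp}_\Delta\theta(\theta^{-1}(f)\mu)\subseteq\operatorname{supp}_\Delta f$ for all $f\in F$, $\mu\in C_0(\Omega)$. Then $\theta$ is bounded, and there are a homeomorphism $\sigma:\Delta\to\Omega$, a bounded continuous function $\psi:\Delta\to\mathbb{R}$ with $\psi(\nu)>0$ for all $\nu\in\Delta$, and for each $\nu\in\Delta$ a unitary operator $J_\nu$ from $\Xi^E_{\sigma(\nu)}$ onto $\Xi^F_\nu$, such that $$\theta(e)(\nu)=\psi(\nu)\,J_\nu(e(\sigma(\nu)))\qquad\text{for all } e\in E,\ \nu\in\Delta,$$ and for each fixed $e\in E$ the map $\Delta\to\Xi^F$, $\nu\mapsto J_\nu(e(\sigma(\nu)))$, is continuous. -/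

import Mathlib

open scoped ZeroAtInfty ComplexOrder InnerProductSpace

noncomputable section

/-- The pointwise order of `C₀(Ω)`, which is its usual order as a C*-algebra. -/
instance ZeroAtInftyContinuousMap.instPartialOrderComplex {Ω : Type*} [TopologicalSpace Ω] :
    PartialOrder C₀(Ω, ℂ) :=
  PartialOrder.lift (fun f : C₀(Ω, ℂ) => (f : Ω → ℂ)) DFunLike.coe_injective

namespace HilbertC0Module

/-! A Hilbert `C₀(Ω)`-module is a complete normed space `E` with an instance
`CStarModule C₀(Ω, ℂ) E`; the action `e a` is written `a • e` (the algebra is commutative), and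
the laws of the action follow from those of the inner product, which is definite.
Its value `⟨x, y⟩` is `⟪x, y⟫_C₀(Ω, ℂ)`, linear in `y`. -/

variable {Ω : Type*} [TopologicalSpace Ω]
  {E : Type*} [NormedAddCommGroup E] [NormedSpace ℂ E] [SMul C₀(Ω, ℂ) E] [CStarModule C₀(Ω, ℂ) E]

/-- The positive semidefinite form `(x, y) ↦ ⟨x, y⟩(ω)`. -/
abbrev preCore (E : Type*) [NormedAddCommGroup E] [NormedSpace ℂ E] [SMul C₀(Ω, ℂ) E]
    [CStarModule C₀(Ω, ℂ) E] (ω : Ω) : PreInnerProductSpace.Core ℂ E where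
  inner x y := ⟪x, y⟫_C₀(Ω, ℂ) ω
  conj_inner_symm x y := by
    rw [← CStarModule.star_inner (A := C₀(Ω, ℂ)) y x]; rfl
  re_inner_nonneg x := by
    have h : (0 : Ω → ℂ) ≤ ⟪x, x⟫_C₀(Ω, ℂ) :=
      CStarModule.inner_self_nonneg (A := C₀(Ω, ℂ)) (x := x)
    exact (Complex.le_def.1 (h ω)).1
  add_left x y z := by simp
  smul_left x y r := by simp

theorem inner_apply_eq_zero {ω : Ω} {x : E} (hx : ⟪x, x⟫_C₀(Ω, ℂ) ω = 0) (y : E) :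
    ⟪x, y⟫_C₀(Ω, ℂ) ω = 0 := by
  have h : ‖⟪x, y⟫_C₀(Ω, ℂ) ω‖ * ‖⟪y, x⟫_C₀(Ω, ℂ) ω‖ ≤
      RCLike.re (⟪x, x⟫_C₀(Ω, ℂ) ω) * RCLike.re (⟪y, y⟫_C₀(Ω, ℂ) ω) :=
    @InnerProductSpace.Core.inner_mul_inner_self_le ℂ E _ _ _ (preCore E ω) x y
  rw [← CStarModule.star_inner (A := C₀(Ω, ℂ)) x y, ZeroAtInftyContinuousMap.star_apply,
    norm_star, hx, map_zero, zero_mul] at h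
  exact norm_eq_zero.1 (mul_self_eq_zero.1 (le_antisymm h (mul_self_nonneg _)))

theorem inner_apply_eq_zero' {ω : Ω} (x : E) {y : E} (hy : ⟪y, y⟫_C₀(Ω, ℂ) ω = 0) :
    ⟪x, y⟫_C₀(Ω, ℂ) ω = 0 := by
  rw [← CStarModule.star_inner (A := C₀(Ω, ℂ)) y x, ZeroAtInftyContinuousMap.star_apply,
    inner_apply_eq_zero hy, star_zero]

/-- The elements of `E` that vanish at `ω`. -/
def vanishing (E : Type*) [NormedAddCommGroup E] [NormedSpace ℂ E] [SMul C₀(Ω, ℂ) E]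
    [CStarModule C₀(Ω, ℂ) E] (ω : Ω) : Submodule ℂ E where
  carrier := {x | ⟪x, x⟫_C₀(Ω, ℂ) ω = 0}
  zero_mem' := by simp
  add_mem' {x y} hx hy := by
    simp only [Set.mem_ofPred_eq] at hx hy ⊢
    simp [hx, hy, inner_apply_eq_zero hx, inner_apply_eq_zero hy]
  smul_mem' c x hx := by
    simp only [Set.mem_ofPred_eq] at hx ⊢
    simp [hx]

/-- The fibre at `ω` of the Hilbert bundle of `E`: the quotient of `E` by the elements that
vanish at `ω`. -/
def Fibre (E : Type*) [NormedAddCommGroup E] [NormedSpace ℂ E] [SMul C₀(Ω, ℂ) E]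
    [CStarModule C₀(Ω, ℂ) E] (ω : Ω) : Type _ :=
  E ⧸ vanishing E ω

/-- The inner product of a fibre: `⟨x(ω), y(ω)⟩ = ⟨x, y⟩(ω)`. -/
abbrev fibreCore (E : Type*) [NormedAddCommGroup E] [NormedSpace ℂ E] [SMul C₀(Ω, ℂ) E]
    [CStarModule C₀(Ω, ℂ) E] (ω : Ω) : InnerProductSpace.Core ℂ (E ⧸ vanishing E ω) where
  inner u v := Quotient.liftOn₂' u v (fun x y => ⟪x, y⟫_C₀(Ω, ℂ) ω) (by
    intro x₁ y₁ x₂ y₂ hx hy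
    rw [Submodule.quotientRel_def] at hx hy
    have h1 := inner_apply_eq_zero hx y₁
    have h2 := inner_apply_eq_zero' x₂ hy
    simp only [CStarModule.inner_sub_left, CStarModule.inner_sub_right,
      ZeroAtInftyContinuousMap.sub_apply] at h1 h2
    exact (sub_eq_zero.1 h1).trans (sub_eq_zero.1 h2))
  conj_inner_symm u v := by
    induction u using Submodule.Quotient.induction_on
    induction v using Submodule.Quotient.induction_on
    exact (preCore E ω).conj_inner_symm _ _
  re_inner_nonneg u := by
    induction u using Submodule.Quotient.induction_on
    exact (preCore E ω).re_inner_nonneg _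
  add_left u v w := by
    induction u using Submodule.Quotient.induction_on
    induction v using Submodule.Quotient.induction_on
    induction w using Submodule.Quotient.induction_on
    exact (preCore E ω).add_left _ _ _
  smul_left u v r := by
    induction u using Submodule.Quotient.induction_on
    induction v using Submodule.Quotient.induction_on
    exact (preCore E ω).smul_left _ _ r
  definite u hu := by
    induction u using Submodule.Quotient.induction_on with
    | H x => exact (Submodule.Quotient.mk_eq_zero _).2 hu

instance (ω : Ω) : NormedAddCommGroup (Fibre E ω) :=
  (fibreCore E ω).toNormedAddCommGroup

instance (ω : Ω) : InnerProductSpace ℂ (Fibre E ω) :=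
  InnerProductSpace.ofCore (fibreCore E ω).toCore

/-- The value `x(ω)` of `x` at `ω`. -/
def eval (ω : Ω) (x : E) : Fibre E ω :=
  Submodule.Quotient.mk x

theorem inner_eval (ω : Ω) (x y : E) : ⟪eval ω x, eval ω y⟫_ℂ = ⟪x, y⟫_C₀(Ω, ℂ) ω := rfl

/-- The total space of the Hilbert bundle of `E` over `Ω`. -/
structure HilbertBundle (Ω E : Type*) [TopologicalSpace Ω] [NormedAddCommGroup E]
    [NormedSpace ℂ E] [SMul C₀(Ω, ℂ) E] [CStarModule C₀(Ω, ℂ) E] where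
  base : Ω
  vec : Fibre E base

/-- The bundle topology, generated by the tubes
`{u over U : ‖u - g(π u)‖ < ε}` with `U` open in `Ω`, `g` in `E` and `ε` real. -/
instance : TopologicalSpace (HilbertBundle Ω E) :=
  TopologicalSpace.generateFrom
    {T | ∃ (U : Set Ω) (g : E) (ε : ℝ), IsOpen U ∧
      T = {u : HilbertBundle Ω E | u.base ∈ U ∧ ‖u.vec - eval u.base g‖ < ε}}

variable (Ω) in
/-- `E` is full: the linear span of its inner products is dense in `C₀(Ω)`. -/
def IsFull (E : Type*) [NormedAddCommGroup E] [NormedSpace ℂ E] [SMul C₀(Ω, ℂ) E]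
    [CStarModule C₀(Ω, ℂ) E] : Prop :=
  Dense (Submodule.span ℂ {a : C₀(Ω, ℂ) | ∃ x y : E, a = ⟪x, y⟫_C₀(Ω, ℂ)} : Set C₀(Ω, ℂ))

variable (Ω) in
/-- The support of `x`: the closure of `{ω : x(ω) ≠ 0}` in `Ω`. -/
def supp (x : E) : Set Ω :=
  closure {ω | eval ω x ≠ 0}

variable {Δ : Type*} [TopologicalSpace Δ]
  {F : Type*} [NormedAddCommGroup F] [NormedSpace ℂ F] [SMul C₀(Δ, ℂ) F] [CStarModule C₀(Δ, ℂ) F]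

variable (Ω Δ) in
/-- `⟨x, y⟩ = 0` implies `⟨θ x, θ y⟩ = 0`. -/
def IsOrthogonalityPreserving (θ : E →ₗ[ℂ] F) : Prop :=
  ∀ x y : E, ⟪x, y⟫_C₀(Ω, ℂ) = 0 → ⟪θ x, θ y⟫_C₀(Δ, ℂ) = 0

variable (Ω Δ) in
/-- A linear bijection `θ` is quasi-local if the support of `θ⁻¹(θ(e) a)` lies in that of `e`
for all `e` in `E` and `a` in `C₀(Δ)`. -/
def IsQuasiLocal (θ : E ≃ₗ[ℂ] F) : Prop :=
  ∀ (e : E) (a : C₀(Δ, ℂ)), supp Ω (θ.symm (a • θ e)) ⊆ supp Ω e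

end HilbertC0Module

end

/-! If `⟪θ e, θ g⟫ = 0`, then `θ e + θ g` is orthogonal to `⟪θ g, θ g⟫ θ e - ⟪θ e, θ e⟫ θ g`.
Applying `θ⁻¹`, quasi-locality upgrades this orthogonality to disjointness of supports, so `θ` is
biseparating. At most one point of `Ω` then lies in the support of `e ↦ θ(e)(ν)`. That there is
such a point `σ(ν)`, and that `e(σ(ν)) = 0` forces `θ(e)(ν) = 0`, is shown without continuity of `θ`
by cutting `e` into layers on which `‖e‖` is of the order of `2⁻ⁿ`: layers of equal parity are
disjoint, and a gliding hump that weights the `n`-th one by `2ⁿ` shows that `e ↦ θ(e)(ν)` kills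
their sum if it kills each of them locally. The induced map of fibres preserves orthogonality,
hence is a positive multiple of a unitary, and `θ` is bounded by the closed graph theorem. -/

noncomputable section

namespace HilbertC0Module

open Filter Topology
open scoped ContinuousMapZero

section Evaluation

variable {Ω : Type*} [TopologicalSpace Ω]
  {E : Type*} [NormedAddCommGroup E] [NormedSpace ℂ E] [SMul C₀(Ω, ℂ) E] [CStarModule C₀(Ω, ℂ) E]

/-- The inner product of a fibre as an inner product space. Without this instance, `⟪u, v⟫_ℂ`
would be read through the `CStarModule ℂ` structure of the fibre, to which the lemmas on inner
product spaces do not apply. -/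
instance instInnerFibre (ω : Ω) : Inner ℂ (Fibre E ω) := InnerProductSpace.toInner

theorem inner_eval_eval (ω : Ω) (x y : E) :
    ⟪eval ω x, eval ω y⟫_ℂ = ⟪x, y⟫_C₀(Ω, ℂ) ω :=
  inner_eval ω x y

theorem norm_eval_sq (ω : Ω) (x : E) : ‖eval ω x‖ ^ 2 = ‖⟪x, x⟫_C₀(Ω, ℂ) ω‖ := by
  rw [← inner_eval_eval, inner_self_eq_norm_sq_to_K]
  simp

theorem norm_eval_eq_sqrt (ω : Ω) (x : E) : ‖eval ω x‖ = √‖⟪x, x⟫_C₀(Ω, ℂ) ω‖ := by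
  rw [← norm_eval_sq, Real.sqrt_sq (norm_nonneg _)]

theorem norm_eval_le (ω : Ω) (x : E) : ‖eval ω x‖ ≤ ‖x‖ := by
  rw [norm_eval_eq_sqrt, CStarModule.norm_eq_sqrt_norm_inner_self (A := C₀(Ω, ℂ)) x]
  exact Real.sqrt_le_sqrt (ZeroAtInftyContinuousMap.toBCF _ |>.norm_coe_le_norm ω)

variable (Ω) in
theorem norm_le_of_forall_norm_eval_le {x : E} {C : ℝ} (hC : 0 ≤ C)
    (h : ∀ ω : Ω, ‖eval ω x‖ ≤ C) : ‖x‖ ≤ C := by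
  rw [CStarModule.norm_eq_sqrt_norm_inner_self (A := C₀(Ω, ℂ)) x]
  refine Real.sqrt_le_iff.2 ⟨hC, ?_⟩
  rw [← ZeroAtInftyContinuousMap.norm_toBCF_eq_norm,
    BoundedContinuousFunction.norm_le (sq_nonneg C)]
  intro ω
  exact (norm_eval_sq ω x).ge.trans (by gcongr; exact h ω)

variable (E) in
/-- Evaluation at `ω` as a continuous linear map. -/
def evalCLM (ω : Ω) : E →L[ℂ] Fibre E ω :=
  LinearMap.mkContinuous ⟨⟨eval ω, fun _ _ => rfl⟩, fun _ _ => rfl⟩ 1 fun x =>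
    (norm_eval_le ω x).trans_eq (one_mul _).symm

@[simp]
theorem eval_zero (ω : Ω) : eval ω (0 : E) = 0 := rfl

@[simp]
theorem eval_add (ω : Ω) (x y : E) : eval ω (x + y) = eval ω x + eval ω y := rfl

@[simp]
theorem eval_sub (ω : Ω) (x y : E) : eval ω (x - y) = eval ω x - eval ω y :=
  map_sub (evalCLM E ω) x y

@[simp]
theorem eval_smul (ω : Ω) (c : ℂ) (x : E) : eval ω (c • x) = c • eval ω x := rfl

theorem eval_surjective (ω : Ω) : Function.Surjective (eval (E := E) ω) :=
  Submodule.Quotient.mk_surjective _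

@[simp]
theorem eval_smul_zeroAtInfty (ω : Ω) (a : C₀(Ω, ℂ)) (x : E) :
    eval ω (a • x) = a ω • eval ω x := by
  refine ext_inner_left ℂ fun v => ?_
  obtain ⟨y, rfl⟩ := eval_surjective ω v
  rw [inner_smul_right, inner_eval_eval, inner_eval_eval]
  simp

theorem inner_eq_zero_iff {x y : E} :
    ⟪x, y⟫_C₀(Ω, ℂ) = 0 ↔ ∀ ω : Ω, ⟪eval ω x, eval ω y⟫_ℂ = 0 := by
  simp only [inner_eval_eval, DFunLike.ext_iff, ZeroAtInftyContinuousMap.zero_apply]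

variable (Ω) in
theorem ext_eval {x y : E} (h : ∀ ω : Ω, eval ω x = eval ω y) : x = y := by
  rw [← sub_eq_zero, ← CStarModule.inner_self (A := C₀(Ω, ℂ)), inner_eq_zero_iff]
  intro ω
  rw [eval_sub, h, sub_self, inner_zero_left]

theorem continuous_norm_eval (x : E) : Continuous fun ω : Ω => ‖eval ω x‖ := by
  simp only [norm_eval_eq_sqrt]
  fun_prop

theorem tendsto_norm_eval_cocompact (x : E) :
    Tendsto (fun ω : Ω => ‖eval ω x‖) (cocompact Ω) (𝓝 0) := by
  simp only [norm_eval_eq_sqrt]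
  have hsqrt := (Real.continuous_sqrt.comp continuous_norm).tendsto (0 : ℂ)
  simpa using! hsqrt.comp (ZeroAtInftyContinuousMap.zero_at_infty' ⟪x, x⟫_C₀(Ω, ℂ))

theorem isCompact_le_norm_eval (x : E) {ε : ℝ} (hε : 0 < ε) :
    IsCompact {ω : Ω | ε ≤ ‖eval ω x‖} := by
  obtain ⟨K, hK, hKs⟩ := mem_cocompact.1
    ((tendsto_norm_eval_cocompact (Ω := Ω) x).eventually_lt_const hε)
  refine hK.of_isClosed_subset (isClosed_le continuous_const (continuous_norm_eval x)) ?_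
  exact fun ω (hω : ε ≤ ‖eval ω x‖) => not_imp_comm.1 (@hKs ω) hω.not_gt

theorem isOpen_eval_ne_zero (x : E) : IsOpen {ω : Ω | eval ω x ≠ 0} := by
  simp only [← norm_pos_iff]
  exact isOpen_lt continuous_const (continuous_norm_eval x)

/-- The module element `ω ↦ k(‖x(ω)‖) x(ω)`, for `k` continuous with `k(0) = 0`. -/
def normSMul (Ω : Type*) [TopologicalSpace Ω]
    {E : Type*} [NormedAddCommGroup E] [NormedSpace ℂ E] [SMul C₀(Ω, ℂ) E]
    [CStarModule C₀(Ω, ℂ) E] (k : C(ℝ, ℝ)₀) (x : E) : E :=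
  letI a : C₀(Ω, ℂ) :=
    { toFun ω := (k ‖eval ω x‖ : ℂ)
      continuous_toFun := by
        have := continuous_norm_eval (Ω := Ω) x
        fun_prop
      zero_at_infty' := by
        have hk : Continuous fun t : ℝ => (k t : ℂ) := by fun_prop
        simpa using! (hk.tendsto 0).comp (tendsto_norm_eval_cocompact (Ω := Ω) x) }
  a • x

@[simp]
theorem eval_normSMul (ω : Ω) (k : C(ℝ, ℝ)₀) (x : E) :
    eval ω (normSMul Ω k x) = (k ‖eval ω x‖ : ℂ) • eval ω x :=
  eval_smul_zeroAtInfty _ _ _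

end Evaluation

theorem exists_zeroAtInfty_eqOn_one {Ω : Type*} [TopologicalSpace Ω] [LocallyCompactSpace Ω]
    [T2Space Ω] {K U : Set Ω} (hK : IsCompact K) (hU : IsOpen U) (hKU : K ⊆ U) :
    ∃ a : C₀(Ω, ℂ), K.EqOn a 1 ∧ (∀ ω ∉ U, a ω = 0) ∧ ∀ ω, ‖a ω‖ ≤ 1 := by
  obtain ⟨f, hf1, hf0, hfc, hf⟩ := exists_continuous_one_zero_of_isCompact hK hU.isClosed_compl
    (Set.disjoint_compl_right_iff_subset.2 hKU)
  refine ⟨⟨⟨fun ω => (f ω : ℂ), by fun_prop⟩, ?_⟩, fun ω hω => ?_, fun ω hω => ?_, fun ω => ?_⟩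
  · simpa using! (Complex.continuous_ofReal.tendsto 0).comp hfc.is_zero_at_infty
  · simpa using! hf1 hω
  · simpa using! hf0 hω
  · simpa [abs_of_nonneg (hf ω).1] using! (hf ω).2

section Full

variable {Ω : Type*} [TopologicalSpace Ω] [LocallyCompactSpace Ω] [T2Space Ω]
  {E : Type*} [NormedAddCommGroup E] [NormedSpace ℂ E] [SMul C₀(Ω, ℂ) E] [CStarModule C₀(Ω, ℂ) E]

theorem IsFull.exists_eval_ne_zero (hE : IsFull Ω E) (ω : Ω) : ∃ x : E, eval ω x ≠ 0 := by
  by_contra! h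
  let δ : C₀(Ω, ℂ) →L[ℂ] ℂ := LinearMap.mkContinuous
    ⟨⟨fun a => a ω, fun _ _ => rfl⟩, fun _ _ => rfl⟩ 1
    fun a => (a.toBCF.norm_coe_le_norm ω).trans_eq (one_mul _).symm
  have hδ : δ = 0 := ContinuousLinearMap.ext_on hE <| by
    rintro _ ⟨x, y, rfl⟩
    change ⟪x, y⟫_C₀(Ω, ℂ) ω = 0
    rw [← inner_eval_eval, h x, inner_zero_left]
  obtain ⟨a, ha, -⟩ := exists_zeroAtInfty_eqOn_one (isCompact_singleton (x := ω)) isOpen_univ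
    (Set.subset_univ _)
  refine one_ne_zero (α := ℂ) ?_
  calc (1 : ℂ) = δ a := (ha rfl).symm
    _ = 0 := by rw [hδ]; rfl

theorem IsFull.exists_norm_eval_eq_one (hE : IsFull Ω E) {U : Set Ω} (hU : IsOpen U) {ω : Ω}
    (hω : ω ∈ U) : ∃ x : E, ‖eval ω x‖ = 1 ∧ ‖x‖ ≤ 1 ∧ ∀ ω' ∉ U, eval ω' x = 0 := by
  obtain ⟨x, hx⟩ := hE.exists_eval_ne_zero ω
  obtain ⟨a, haω, haU, ha⟩ := exists_zeroAtInfty_eqOn_one (isCompact_singleton (x := ω)) hU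
    (Set.singleton_subset_iff.2 hω)
  set r := ‖eval ω x‖
  have hr : 0 < r := norm_pos_iff.2 hx
  have hmax (t : ℝ) : 0 < max t r := lt_max_of_lt_right hr
  let k : C(ℝ, ℝ)₀ :=
    ⟨⟨fun t => t / max t r ^ 2, continuous_id.div (by fun_prop) fun t => (pow_pos (hmax t) 2).ne'⟩,
      zero_div _⟩
  have hk_apply (t : ℝ) : k t = t / max t r ^ 2 := rfl
  have hk (ω' : Ω) : ‖eval ω' (normSMul Ω k x)‖ = (‖eval ω' x‖ / max ‖eval ω' x‖ r) ^ 2 := by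
    rw [eval_normSMul, norm_smul, Complex.norm_real, hk_apply, Real.norm_of_nonneg (by positivity)]
    ring
  refine ⟨a • normSMul Ω k x, ?_, ?_, fun ω' hω' => ?_⟩
  · rw [eval_smul_zeroAtInfty, haω rfl, Pi.one_apply, one_smul, hk, max_self, div_self hr.ne',
      one_pow]
  · refine norm_le_of_forall_norm_eval_le Ω zero_le_one fun ω' => ?_
    rw [eval_smul_zeroAtInfty, norm_smul, hk]
    refine mul_le_one₀ (ha ω') (by positivity) (pow_le_one₀ (by positivity) ?_)
    exact div_le_one_of_le₀ (le_max_left _ _) (by positivity)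
  · rw [eval_smul_zeroAtInfty, haU ω' hω', zero_smul]

theorem IsFull.eq_of_forall_eval_eq_zero (hE : IsFull Ω E) {ω ω' : Ω}
    (h : ∀ x : E, eval ω x = 0 → eval ω' x = 0) : ω = ω' := by
  by_contra hne
  obtain ⟨x, hx, -, hx0⟩ :=
    hE.exists_norm_eval_eq_one (isOpen_compl_singleton (x := ω)) (Ne.symm hne)
  simp [h x (hx0 ω (by simp))] at hx

theorem IsFull.continuous_of_isOpen_eval_ne_zero (hE : IsFull Ω E) {X : Type*}
    [TopologicalSpace X] {s : X → Ω} (h : ∀ x : E, IsOpen {ν | eval (s ν) x ≠ 0}) :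
    Continuous s := by
  refine continuous_def.2 fun U hU => isOpen_iff_mem_nhds.2 fun ν hν => ?_
  obtain ⟨x, hx, -, hx0⟩ := hE.exists_norm_eval_eq_one hU hν
  have hν' : eval (s ν) x ≠ 0 := norm_ne_zero_iff.1 (hx.trans_ne one_ne_zero)
  filter_upwards [(h x).mem_nhds hν'] with ν' hx'
  exact not_imp_comm.1 (hx0 (s ν')) hx'

end Full

section Disjoint

variable {Ω : Type*} [TopologicalSpace Ω]
  {E : Type*} [NormedAddCommGroup E] [NormedSpace ℂ E] [SMul C₀(Ω, ℂ) E] [CStarModule C₀(Ω, ℂ) E]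
  {Δ : Type*} [TopologicalSpace Δ]
  {F : Type*} [NormedAddCommGroup F] [NormedSpace ℂ F] [SMul C₀(Δ, ℂ) F] [CStarModule C₀(Δ, ℂ) F]

variable (Ω) in
/-- `x` and `y` are disjoint if at each point of `Ω` one of them vanishes. -/
def IsDisjoint (x y : E) : Prop := ∀ ω : Ω, eval ω x = 0 ∨ eval ω y = 0

theorem IsDisjoint.symm {x y : E} (h : IsDisjoint Ω x y) : IsDisjoint Ω y x :=
  fun ω => (h ω).symm

theorem IsDisjoint.inner_eq_zero {x y : E} (h : IsDisjoint Ω x y) : ⟪x, y⟫_C₀(Ω, ℂ) = 0 :=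
  inner_eq_zero_iff.2 fun ω => by rcases h ω with h | h <;> simp [h]

theorem IsDisjoint.of_supp_subset {x x' y : E} (h : IsDisjoint Ω x y)
    (hx : supp Ω x' ⊆ supp Ω x) : IsDisjoint Ω x' y := by
  intro ω
  by_contra! hω
  obtain ⟨ω', hy, hx⟩ :=
    mem_closure_iff.1 (hx (subset_closure hω.1)) _ (isOpen_eval_ne_zero y) hω.2
  exact (h ω').elim hx hy

theorem IsDisjoint.inner_eq_zero_of_inner_add_sub {e g u v : E} (heg : IsDisjoint Ω e g)
    (hu : supp Ω u ⊆ supp Ω e) (hv : supp Ω v ⊆ supp Ω g) (h : ⟪e + g, u - v⟫_C₀(Ω, ℂ) = 0) :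
    ⟪e, u⟫_C₀(Ω, ℂ) = 0 := by
  have hev := (heg.symm.of_supp_subset hv).symm.inner_eq_zero
  have hgu := (heg.of_supp_subset hu).symm.inner_eq_zero
  have heu : ⟪e, u⟫_C₀(Ω, ℂ) = ⟪g, v⟫_C₀(Ω, ℂ) := by
    simpa [hev, hgu, sub_eq_zero] using h
  refine inner_eq_zero_iff.2 fun ω => ?_
  rcases heg ω with he | hg
  · rw [he, inner_zero_left]
  · rw [inner_eval_eval, heu, ← inner_eval_eval, hg, inner_zero_left]

theorem inner_add_inner_smul_sub_inner_smul {x y : E} (h : ⟪x, y⟫_C₀(Ω, ℂ) = 0) :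
    ⟪x + y, ⟪y, y⟫_C₀(Ω, ℂ) • x - ⟪x, x⟫_C₀(Ω, ℂ) • y⟫_C₀(Ω, ℂ) = 0 := by
  refine inner_eq_zero_iff.2 fun ω => ?_
  have hxy := inner_eq_zero_iff.1 h ω
  have hyx := inner_eq_zero_symm.1 hxy
  simp only [eval_add, eval_sub, eval_smul_zeroAtInfty, inner_add_left, inner_sub_right,
    inner_smul_right, hxy, hyx, ← inner_eval_eval]
  ring

variable (Ω Δ) in
/-- A map is separating if it maps disjoint elements to disjoint elements. -/
def IsSeparating (θ : E → F) : Prop :=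
  ∀ ⦃x y : E⦄, IsDisjoint Ω x y → IsDisjoint Δ (θ x) (θ y)

variable (Ω Δ) in
/-- A linear bijection is biseparating if it and its inverse are separating. -/
structure IsBiseparating (θ : E ≃ₗ[ℂ] F) : Prop where
  isSeparating : IsSeparating Ω Δ θ
  isSeparating_symm : IsSeparating Δ Ω θ.symm

theorem IsBiseparating.symm {θ : E ≃ₗ[ℂ] F} (hθ : IsBiseparating Ω Δ θ) :
    IsBiseparating Δ Ω θ.symm :=
  ⟨hθ.isSeparating_symm, hθ.isSeparating⟩

theorem IsQuasiLocal.isSeparating {θ : E ≃ₗ[ℂ] F} (hql : IsQuasiLocal Ω Δ θ)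
    (hop : IsOrthogonalityPreserving Ω Δ (θ : E →ₗ[ℂ] F))
    (hop' : IsOrthogonalityPreserving Δ Ω (θ.symm : F →ₗ[ℂ] E)) :
    IsSeparating Ω Δ θ := by
  intro e g heg
  set q := ⟪θ g, θ g⟫_C₀(Δ, ℂ) with hq
  have hθ : ⟪θ e, θ g⟫_C₀(Δ, ℂ) = 0 := hop e g heg.inner_eq_zero
  have hsymm := hop' _ _ (inner_add_inner_smul_sub_inner_smul hθ)
  simp only [map_add, map_sub, LinearEquiv.coe_coe, LinearEquiv.symm_apply_apply] at hsymm
  have he : ⟪e, θ.symm (q • θ e)⟫_C₀(Ω, ℂ) = 0 :=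
    heg.inner_eq_zero_of_inner_add_sub (hql e q) (hql g _) hsymm
  have hqe : ⟪θ e, q • θ e⟫_C₀(Δ, ℂ) = 0 := by simpa using hop _ _ he
  intro ν
  have hν := inner_eq_zero_iff.1 hqe ν
  rw [eval_smul_zeroAtInfty, inner_smul_right, mul_eq_zero, hq, ← inner_eval_eval,
    inner_self_eq_zero, inner_self_eq_zero] at hν
  exact hν.symm

end Disjoint

section GlidingHump

variable {Ω : Type*} [TopologicalSpace Ω]
  {E : Type*} [NormedAddCommGroup E] [NormedSpace ℂ E] [SMul C₀(Ω, ℂ) E] [CStarModule C₀(Ω, ℂ) E]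
  {Δ : Type*} [TopologicalSpace Δ]
  {F : Type*} [NormedAddCommGroup F] [NormedSpace ℂ F] [SMul C₀(Δ, ℂ) F] [CStarModule C₀(Δ, ℂ) F]

theorem eval_tsum {ι : Type*} {h : ι → E} (hs : Summable h) (ω : Ω) :
    eval ω (∑' n, h n) = ∑' n, eval ω (h n) :=
  (evalCLM E ω).map_tsum hs

theorem eval_tsum_eq_single {ι : Type*} {h : ι → E} (hs : Summable h) {ω : Ω} (n : ι)
    (h0 : ∀ m ≠ n, eval ω (h m) = 0) : eval ω (∑' m, h m) = eval ω (h n) := by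
  rw [eval_tsum hs, tsum_eq_single n h0]

-- Where `θ (h n)` does not vanish, `θ g = c n • θ x`; near `ν` this is too large for large `n`.
theorem IsSeparating.eventually_forall_eval_map_eq_zero {θ : E →ₗ[ℂ] F}
    (hθ : IsSeparating Ω Δ θ) {h : ℕ → E} {c : ℕ → ℂ} {x g : E}
    (hc : Tendsto (fun n => ‖c n‖) atTop atTop) (hd : ∀ n, IsDisjoint Ω (h n) (g - c n • x))
    {ν : Δ} (hx : eval ν (θ x) ≠ 0) (hν : ∀ n, ∀ᶠ ν' in 𝓝 ν, eval ν' (θ (h n)) = 0) :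
    ∀ᶠ ν' in 𝓝 ν, ∀ n, eval ν' (θ (h n)) = 0 := by
  obtain ⟨δ, hδ, hδx⟩ := exists_between (norm_pos_iff.2 hx)
  obtain ⟨M, hM⟩ := exists_gt ‖eval ν (θ g)‖
  obtain ⟨N, hN⟩ := eventually_atTop.1 (hc.eventually_ge_atTop (M / δ))
  filter_upwards [((continuous_norm_eval (θ x)).tendsto ν).eventually_const_lt hδx,
    ((continuous_norm_eval (θ g)).tendsto ν).eventually_lt_const hM,
    (Set.finite_lt_nat N).eventually_all.2 fun n _ => hν n] with ν' hx' hg' hlt n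
  by_contra hn
  have hg : eval ν' (θ g) = c n • eval ν' (θ x) := by
    simpa [sub_eq_zero] using (hθ (hd n) ν').resolve_left hn
  have hMc : M ≤ ‖c n‖ * δ := (div_le_iff₀ hδ).1 (hN n (not_lt.1 fun h => hn (hlt n h)))
  refine hg'.not_ge (hMc.trans ?_)
  rw [hg, norm_smul]
  gcongr

variable [LocallyCompactSpace Δ] [T2Space Δ]

theorem IsBiseparating.eval_map_tsum_eq_zero_of_eventually {θ : E ≃ₗ[ℂ] F}
    (hθ : IsBiseparating Ω Δ θ) {ι : Type*} {h : ι → E} (hs : Summable h) {ν : Δ}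
    (hν : ∀ᶠ ν' in 𝓝 ν, ∀ n, eval ν' (θ (h n)) = 0) : eval ν (θ (∑' n, h n)) = 0 := by
  obtain ⟨V, hV, hVo, hνV⟩ := eventually_nhds_iff.1 hν
  obtain ⟨a, haν, haV, -⟩ := exists_zeroAtInfty_eqOn_one (isCompact_singleton (x := ν)) hVo
    (Set.singleton_subset_iff.2 hνV)
  set x := ∑' n, h n with hx
  have hax (n : ι) : IsDisjoint Δ (a • θ x) (θ (h n)) := fun ν' => by
    by_cases hν' : ν' ∈ V
    · exact Or.inr (hV ν' hν' n)
    · exact Or.inl (by rw [eval_smul_zeroAtInfty, haV ν' hν', zero_smul])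
  have hsymm : IsDisjoint Ω (θ.symm (a • θ x)) x := fun ω => by
    refine or_iff_not_imp_left.2 fun hω => ?_
    have hn (n : ι) : eval ω (h n) = 0 := by
      simpa [hω] using hθ.isSeparating_symm (hax n) ω
    rw [hx, eval_tsum hs, tsum_congr hn, tsum_zero]
  simpa [haν rfl] using hθ.isSeparating hsymm ν

theorem IsBiseparating.eval_map_tsum_eq_zero {θ : E ≃ₗ[ℂ] F} (hθ : IsBiseparating Ω Δ θ)
    {h : ℕ → E} (hd : Pairwise fun n m => IsDisjoint Ω (h n) (h m)) {c : ℕ → ℂ}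
    (hc : Tendsto (fun n => ‖c n‖) atTop atTop) (hs : Summable h)
    (hsc : Summable fun n => c n • h n) {ν : Δ} (hν : ∀ n, ∀ᶠ ν' in 𝓝 ν, eval ν' (θ (h n)) = 0) :
    eval ν (θ (∑' n, h n)) = 0 := by
  have hdc (n : ℕ) : IsDisjoint Ω (h n) (∑' n, c n • h n - c n • ∑' n, h n) := fun ω => by
    refine or_iff_not_imp_left.2 fun hn => ?_
    have hm (m : ℕ) (hmn : m ≠ n) : eval ω (h m) = 0 := (hd hmn ω).resolve_right hn
    rw [eval_sub, eval_smul, eval_tsum_eq_single hs n hm,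
      eval_tsum_eq_single hsc n fun m hmn => by rw [eval_smul, hm m hmn, smul_zero],
      eval_smul, sub_self]
  by_contra hne
  exact hne <| hθ.eval_map_tsum_eq_zero_of_eventually hs <|
    IsSeparating.eventually_forall_eval_map_eq_zero (θ := (θ : E →ₗ[ℂ] F)) hθ.isSeparating hc hdc
      hne hν

end GlidingHump

section NullSet

variable {Ω : Type*} [TopologicalSpace Ω]
  {E : Type*} [NormedAddCommGroup E] [NormedSpace ℂ E] [SMul C₀(Ω, ℂ) E] [CStarModule C₀(Ω, ℂ) E]
  {Δ : Type*} [TopologicalSpace Δ]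
  {F : Type*} [NormedAddCommGroup F] [NormedSpace ℂ F] [SMul C₀(Δ, ℂ) F] [CStarModule C₀(Δ, ℂ) F]

/-- `U` is null for `e ↦ θ(e)(ν)` if this map vanishes on the elements that vanish off `U`. The
points without null neighbourhoods thus form the support of this map. -/
def IsNullSet (θ : E → F) (ν : Δ) (U : Set Ω) : Prop :=
  ∀ x : E, (∀ ω ∉ U, eval ω x = 0) → eval ν (θ x) = 0

theorem IsSeparating.eq_of_not_isNullSet [T2Space Ω] {θ : E → F} (hθ : IsSeparating Ω Δ θ) {ν : Δ}
    {ω ω' : Ω} (hω : ∀ U ∈ 𝓝 ω, ¬ IsNullSet θ ν U) (hω' : ∀ U ∈ 𝓝 ω', ¬ IsNullSet θ ν U) :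
    ω = ω' := by
  by_contra hne
  obtain ⟨U, V, hU, hV, hωU, hωV, hUV⟩ := t2_separation hne
  have hU := hω U (hU.mem_nhds hωU)
  have hV := hω' V (hV.mem_nhds hωV)
  simp only [IsNullSet, not_forall] at hU hV
  obtain ⟨x, hx, hxν⟩ := hU
  obtain ⟨y, hy, hyν⟩ := hV
  have hxy : IsDisjoint Ω x y := fun ω =>
    (em (ω ∈ U)).symm.imp (hx ω) fun h => hy ω (Set.disjoint_left.1 hUV h)
  exact (hθ hxy ν).elim hxν hyν

variable [LocallyCompactSpace Ω] [T2Space Ω]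

theorem exists_eqOn_one_forall_eval_map_smul_eq_zero (θ : E →ₗ[ℂ] F) (ν : Δ) {K : Set Ω}
    (hK : IsCompact K) (hKν : ∀ ω ∈ K, ∃ U ∈ 𝓝 ω, IsNullSet θ ν U) :
    ∃ a : C₀(Ω, ℂ), K.EqOn a 1 ∧ ∀ e : E, eval ν (θ (a • e)) = 0 := by
  refine hK.induction_on
    (p := fun s => ∃ a : C₀(Ω, ℂ), s.EqOn a 1 ∧ ∀ e : E, eval ν (θ (a • e)) = 0) ?_ ?_ ?_ ?_
  · have hzero (e : E) : (0 : C₀(Ω, ℂ)) • e = 0 := ext_eval Ω fun ω => by simp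
    exact ⟨0, Set.eqOn_empty _ _, fun e => by rw [hzero, map_zero, eval_zero]⟩
  · exact fun s t hst ⟨a, hat, ha⟩ => ⟨a, hat.mono hst, ha⟩
  · rintro s t ⟨a, has, ha⟩ ⟨b, hbt, hb⟩
    refine ⟨a + b - a * b, fun ω hω => ?_, fun e => ?_⟩
    · rcases hω with hω | hω
      · simp [has hω]
      · simp [hbt hω]
    · have hab : (a + b - a * b) • e = a • e + b • (e - a • e) := ext_eval Ω fun ω => by
        simp only [eval_add, eval_sub, eval_smul_zeroAtInfty, ZeroAtInftyContinuousMap.add_apply,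
          ZeroAtInftyContinuousMap.sub_apply, ZeroAtInftyContinuousMap.mul_apply]
        module
      rw [hab, map_add, eval_add, ha, hb, add_zero]
  · intro ω hω
    obtain ⟨U, hU, hUν⟩ := hKν ω hω
    obtain ⟨L, hL, hωL, hLU⟩ :=
      exists_compact_subset isOpen_interior (mem_interior_iff_mem_nhds.2 hU)
    obtain ⟨a, haL, haU, -⟩ := exists_zeroAtInfty_eqOn_one hL isOpen_interior hLU
    refine ⟨L, mem_nhdsWithin_of_mem_nhds (mem_interior_iff_mem_nhds.1 hωL), a, haL, fun e => ?_⟩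
    refine hUν _ fun ω' hω' => ?_
    rw [eval_smul_zeroAtInfty, haU ω' fun h => hω' (interior_subset h), zero_smul]

theorem IsSeparating.eventually_eval_map_eq_zero {θ : E →ₗ[ℂ] F} (hθ : IsSeparating Ω Δ θ) {ν : Δ}
    {e : E} (he : eval ν (θ e) ≠ 0) {K : Set Ω} (hK : IsCompact K)
    (hKν : ∀ ω ∈ K, ∃ U ∈ 𝓝 ω, IsNullSet θ ν U) {x : E} (hx : ∀ ω ∉ K, eval ω x = 0) :
    ∀ᶠ ν' in 𝓝 ν, eval ν' (θ x) = 0 := by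
  obtain ⟨a, haK, ha⟩ := exists_eqOn_one_forall_eval_map_smul_eq_zero θ ν hK hKν
  have hd : IsDisjoint Ω (e - a • e) x := fun ω =>
    (em (ω ∈ K)).imp (fun h => by simp [haK h]) (hx ω)
  have hne : eval ν (θ (e - a • e)) ≠ 0 := by rwa [map_sub, eval_sub, ha, sub_zero]
  filter_upwards [(isOpen_eval_ne_zero _).mem_nhds hne] with ν' hν'
  exact (hθ hd ν').resolve_left hν'

end NullSet

section Layers

variable {Ω : Type*} [TopologicalSpace Ω]
  {E : Type*} [NormedAddCommGroup E] [NormedSpace ℂ E] [SMul C₀(Ω, ℂ) E] [CStarModule C₀(Ω, ℂ) E]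

/-- A continuous cutoff at height `2⁻ⁿ`: it is `0` for `t ≤ 2⁻ⁿ` and `1` for `2 * 2⁻ⁿ ≤ t`. -/
def cutoff (n : ℕ) : C(ℝ, ℝ)₀ :=
  ⟨⟨fun t => max 0 (min 1 (2 ^ n * t - 1)), by fun_prop⟩, by simp⟩

theorem cutoff_apply (n : ℕ) (t : ℝ) : cutoff n t = max 0 (min 1 (2 ^ n * t - 1)) := rfl

theorem cutoff_of_le {n : ℕ} {t : ℝ} (h : 2 ^ n * t ≤ 1) : cutoff n t = 0 :=
  max_eq_left ((min_le_right _ _).trans (sub_nonpos.2 h))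

theorem cutoff_of_ge {n : ℕ} {t : ℝ} (h : 2 ≤ 2 ^ n * t) : cutoff n t = 1 := by
  rw [cutoff_apply, min_eq_left (by linarith), max_eq_right zero_le_one]

theorem one_sub_cutoff_mem_Icc (n : ℕ) (t : ℝ) : 1 - cutoff n t ∈ Set.Icc (0 : ℝ) 1 :=
  ⟨sub_nonneg.2 (max_le zero_le_one (min_le_left _ _)), sub_le_self _ (le_max_left _ _)⟩

variable (Ω) in
/-- The part of `e` where `‖e(ω)‖` exceeds `2⁻ⁿ`. -/
def truncate (n : ℕ) (e : E) : E := normSMul Ω (cutoff n) e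

theorem eval_truncate_of_le {n : ℕ} {e : E} {ω : Ω} (h : 2 ^ n * ‖eval ω e‖ ≤ 1) :
    eval ω (truncate Ω n e) = 0 := by
  rw [truncate, eval_normSMul, cutoff_of_le h, Complex.ofReal_zero, zero_smul]

theorem eval_truncate_of_ge {n : ℕ} {e : E} {ω : Ω} (h : 2 ≤ 2 ^ n * ‖eval ω e‖) :
    eval ω (truncate Ω n e) = eval ω e := by
  rw [truncate, eval_normSMul, cutoff_of_ge h, Complex.ofReal_one, one_smul]

variable (Ω) in
theorem norm_sub_truncate_le (n : ℕ) (e : E) : ‖e - truncate Ω n e‖ ≤ 2 * (1 / 2) ^ n := by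
  refine norm_le_of_forall_norm_eval_le Ω (by positivity) fun ω => ?_
  rcases le_total 2 (2 ^ n * ‖eval ω e‖) with h | h
  · rw [eval_sub, eval_truncate_of_ge h, sub_self, norm_zero]
    positivity
  · obtain ⟨h0, h1⟩ := one_sub_cutoff_mem_Icc n ‖eval ω e‖
    have heval : eval ω (e - truncate Ω n e) = ((1 - cutoff n ‖eval ω e‖ : ℝ) : ℂ) • eval ω e := by
      rw [eval_sub, truncate, eval_normSMul, Complex.ofReal_sub, Complex.ofReal_one, sub_smul,
        one_smul]
    calc ‖eval ω (e - truncate Ω n e)‖ = (1 - cutoff n ‖eval ω e‖) * ‖eval ω e‖ := by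
          rw [heval, norm_smul, Complex.norm_real, Real.norm_of_nonneg h0]
      _ ≤ 1 * ‖eval ω e‖ := by gcongr
      _ = 2 ^ n * ‖eval ω e‖ * (1 / 2) ^ n := by
          rw [mul_right_comm, ← mul_pow, mul_one_div_cancel two_ne_zero, one_pow]
      _ ≤ 2 * (1 / 2) ^ n := by gcongr

variable (Ω) in
/-- The part of `e` where `‖e(ω)‖` is of the order of `2⁻ⁿ`. -/
def layer (n : ℕ) (e : E) : E := truncate Ω (n + 1) e - truncate Ω n e

theorem eval_layer_of_le {n : ℕ} {e : E} {ω : Ω} (h : 2 ^ (n + 1) * ‖eval ω e‖ ≤ 1) :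
    eval ω (layer Ω n e) = 0 := by
  have h' : 2 ^ n * ‖eval ω e‖ ≤ 1 := le_trans (by gcongr <;> simp) h
  rw [layer, eval_sub, eval_truncate_of_le h, eval_truncate_of_le h', sub_self]

theorem eval_layer_of_ge {n : ℕ} {e : E} {ω : Ω} (h : 2 ≤ 2 ^ n * ‖eval ω e‖) :
    eval ω (layer Ω n e) = 0 := by
  have h' : 2 ≤ 2 ^ (n + 1) * ‖eval ω e‖ := h.trans (by gcongr <;> simp)
  rw [layer, eval_sub, eval_truncate_of_ge h, eval_truncate_of_ge h', sub_self]

theorem isDisjoint_layer {n m : ℕ} (h : n + 2 ≤ m) (e : E) :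
    IsDisjoint Ω (layer Ω n e) (layer Ω m e) := by
  intro ω
  refine (le_total (2 ^ (n + 1) * ‖eval ω e‖) 1).imp eval_layer_of_le fun h1 => ?_
  refine eval_layer_of_ge ?_
  calc (2 : ℝ) ≤ 2 * (2 ^ (n + 1) * ‖eval ω e‖) := by linarith
    _ = 2 ^ (n + 2) * ‖eval ω e‖ := by ring
    _ ≤ 2 ^ m * ‖eval ω e‖ := by gcongr; norm_num

variable (Ω) in
theorem norm_layer_le (n : ℕ) (e : E) : ‖layer Ω n e‖ ≤ 4 * (1 / 2) ^ n := by
  calc ‖layer Ω n e‖ = ‖(e - truncate Ω n e) - (e - truncate Ω (n + 1) e)‖ := by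
        rw [layer, sub_sub_sub_cancel_left]
    _ ≤ 2 * (1 / 2) ^ n + 2 * (1 / 2) ^ (n + 1) :=
        (norm_sub_le _ _).trans (add_le_add (norm_sub_truncate_le Ω n e)
          (norm_sub_truncate_le Ω (n + 1) e))
    _ ≤ 4 * (1 / 2) ^ n := by
        have : (0 : ℝ) < (1 / 2) ^ n := by positivity
        rw [pow_succ]
        linarith

variable [CompleteSpace E]

variable (Ω) in
theorem summable_layer (e : E) : Summable fun n => layer Ω n e :=
  .of_norm_bounded (summable_geometric_two.mul_left 4) fun n => norm_layer_le Ω n e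

variable (Ω) in
theorem tsum_layer (e : E) : ∑' n, layer Ω n e = e - truncate Ω 0 e := by
  refine ((summable_layer Ω e).hasSum_iff_tendsto_nat.2 ?_).tsum_eq
  simp only [layer, Finset.sum_range_sub (fun n => truncate Ω n e)]
  refine Tendsto.sub_const (tendsto_iff_norm_sub_tendsto_zero.2 ?_) _
  refine squeeze_zero (fun _ => norm_nonneg _)
    (fun n => (norm_sub_rev _ _).trans_le (norm_sub_truncate_le Ω n e)) ?_
  simpa using (tendsto_pow_atTop_nhds_zero_of_lt_one (by norm_num)
    (by norm_num : (1 / 2 : ℝ) < 1)).const_mul 2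

variable (Ω) in
theorem truncate_zero_add_tsum_layer (e : E) :
    truncate Ω 0 e + (∑' n, layer Ω (2 * n) e + ∑' n, layer Ω (2 * n + 1) e) = e := by
  have hs := summable_layer Ω e
  rw [tsum_even_add_odd (f := fun n => layer Ω n e)
    (hs.comp_injective (i := fun n => 2 * n) fun a b h => by simpa using h)
    (hs.comp_injective (i := fun n => 2 * n + 1) fun a b h => by simpa using h), tsum_layer,
    add_sub_cancel]

end Layers

section Localization

variable {Ω : Type*} [TopologicalSpace Ω]
  {E : Type*} [NormedAddCommGroup E] [NormedSpace ℂ E] [SMul C₀(Ω, ℂ) E] [CStarModule C₀(Ω, ℂ) E]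
  {Δ : Type*} [TopologicalSpace Δ]
  {F : Type*} [NormedAddCommGroup F] [NormedSpace ℂ F] [SMul C₀(Δ, ℂ) F] [CStarModule C₀(Δ, ℂ) F]

/-- `θ(e)(ν)` depends on `e(ω)` only. -/
def IsLocalizedAt (θ : E → F) (ω : Ω) (ν : Δ) : Prop :=
  ∀ e : E, eval ω e = 0 → eval ν (θ e) = 0

variable [CompleteSpace E] [LocallyCompactSpace Δ] [T2Space Δ]

theorem IsBiseparating.eval_map_tsum_layer_eq_zero {θ : E ≃ₗ[ℂ] F} (hθ : IsBiseparating Ω Δ θ)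
    {ν : Δ} {e : E} (hν : ∀ n, ∀ᶠ ν' in 𝓝 ν, eval ν' (θ (layer Ω n e)) = 0) (j : ℕ) :
    eval ν (θ (∑' n, layer Ω (2 * n + j) e)) = 0 := by
  have hd : Pairwise fun n m => IsDisjoint Ω (layer Ω (2 * n + j) e) (layer Ω (2 * m + j) e) :=
    fun n m hnm => hnm.lt_or_gt.elim (fun h => isDisjoint_layer (by omega) e)
      fun h => (isDisjoint_layer (by omega) e).symm
  have hs : Summable fun n => layer Ω (2 * n + j) e :=
    (summable_layer Ω e).comp_injective (i := fun n => 2 * n + j) fun a b h => by simpa using h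
  have hsc : Summable fun n => (2 ^ n : ℂ) • layer Ω (2 * n + j) e := by
    refine .of_norm_bounded (summable_geometric_two.mul_left 4) fun n => ?_
    calc ‖(2 ^ n : ℂ) • layer Ω (2 * n + j) e‖ = 2 ^ n * ‖layer Ω (2 * n + j) e‖ := by
          rw [norm_smul, norm_pow, Complex.norm_ofNat]
      _ ≤ 2 ^ n * (4 * (1 / 2) ^ (2 * n + j)) := by gcongr; exact norm_layer_le Ω _ e
      _ ≤ 2 ^ n * (4 * (1 / 2) ^ (2 * n)) := by
          gcongr 2 ^ n * (4 * ?_)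
          exact pow_le_pow_of_le_one (by norm_num) (by norm_num) (Nat.le_add_right _ _)
      _ = 4 * (1 / 2) ^ n := by
          rw [two_mul, pow_add, mul_left_comm, ← mul_assoc (2 ^ n), ← mul_pow,
            mul_one_div_cancel two_ne_zero, one_pow, one_mul]
  refine hθ.eval_map_tsum_eq_zero hd (c := fun n => 2 ^ n) ?_ hs hsc fun n => hν _
  simpa using tendsto_pow_atTop_atTop_of_one_lt (one_lt_two (α := ℝ))

variable [LocallyCompactSpace Ω] [T2Space Ω]

theorem IsBiseparating.eval_map_eq_zero_of_isNullSet {θ : E ≃ₗ[ℂ] F} (hθ : IsBiseparating Ω Δ θ)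
    {ν : Δ} {e : E} (h : ∀ ω : Ω, eval ω e ≠ 0 → ∃ U ∈ 𝓝 ω, IsNullSet θ ν U) :
    eval ν (θ e) = 0 := by
  by_contra hne
  have hnear (n : ℕ) (x : E) (hx : ∀ ω : Ω, 2 ^ n * ‖eval ω e‖ ≤ 1 → eval ω x = 0) :
      ∀ᶠ ν' in 𝓝 ν, eval ν' (θ x) = 0 := by
    have hn : (0 : ℝ) < (2 ^ n)⁻¹ := by positivity
    refine IsSeparating.eventually_eval_map_eq_zero (θ := (θ : E →ₗ[ℂ] F)) hθ.isSeparating hne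
      (isCompact_le_norm_eval e hn) (fun ω hω => h ω (norm_pos_iff.1 (hn.trans_le hω)))
      fun ω hω => hx ω ?_
    exact (le_inv_mul_iff₀ (by positivity)).1 ((not_le.1 hω).le.trans_eq (mul_one _).symm)
  have hlayer := hθ.eval_map_tsum_layer_eq_zero fun n =>
    hnear (n + 1) (layer Ω n e) fun _ hω => eval_layer_of_le hω
  have htruncate : eval ν (θ (truncate Ω 0 e)) = 0 :=
    (hnear 0 _ fun _ hω => eval_truncate_of_le hω).self_of_nhds
  refine hne ?_
  rw [← truncate_zero_add_tsum_layer Ω e, map_add, map_add, eval_add, eval_add, htruncate,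
    hlayer 1, add_zero, zero_add]
  exact hlayer 0

theorem IsBiseparating.exists_isLocalizedAt (hF : IsFull Δ F) {θ : E ≃ₗ[ℂ] F}
    (hθ : IsBiseparating Ω Δ θ) (ν : Δ) : ∃ ω : Ω, IsLocalizedAt θ ω ν := by
  have hsupp {e : E} (he : eval ν (θ e) ≠ 0) :
      ∃ ω : Ω, eval ω e ≠ 0 ∧ ∀ U ∈ 𝓝 ω, ¬ IsNullSet θ ν U := by
    contrapose! he
    exact hθ.eval_map_eq_zero_of_isNullSet he
  obtain ⟨f, hf⟩ := hF.exists_eval_ne_zero ν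
  obtain ⟨ω, -, hω⟩ := hsupp (e := θ.symm f) (by rwa [θ.apply_symm_apply])
  refine ⟨ω, fun e he => by_contra fun hne => ?_⟩
  obtain ⟨ω', he', hω'⟩ := hsupp hne
  exact he' (hθ.isSeparating.eq_of_not_isNullSet hω hω' ▸ he)

theorem IsBiseparating.exists_homeomorph [CompleteSpace F] (hE : IsFull Ω E) (hF : IsFull Δ F)
    {θ : E ≃ₗ[ℂ] F} (hθ : IsBiseparating Ω Δ θ) :
    ∃ σ : Δ ≃ₜ Ω, ∀ ν, IsLocalizedAt θ (σ ν) ν := by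
  choose s hs using hθ.exists_isLocalizedAt hF
  choose t ht using hθ.symm.exists_isLocalizedAt hE
  have hst (ω : Ω) : s (t ω) = ω := hE.eq_of_forall_eval_eq_zero fun e he => by
    simpa using ht ω (θ e) (hs (t ω) e he)
  have hts (ν : Δ) : t (s ν) = ν := hF.eq_of_forall_eval_eq_zero fun f hf => by
    simpa using hs ν (θ.symm f) (ht (s ν) f hf)
  have hs_ne (e : E) (ν : Δ) : eval (s ν) e ≠ 0 ↔ eval ν (θ e) ≠ 0 := by
    refine not_congr ⟨hs ν e, fun h => ?_⟩
    have := ht (s ν) (θ e)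
    rw [hts, θ.symm_apply_apply] at this
    exact this h
  have ht_ne (f : F) (ω : Ω) : eval (t ω) f ≠ 0 ↔ eval ω (θ.symm f) ≠ 0 := by
    rw [← θ.apply_symm_apply f, ← hs_ne, hst, θ.symm_apply_apply]
  refine ⟨⟨⟨s, t, hts, hst⟩, ?_, ?_⟩, hs⟩
  · refine hE.continuous_of_isOpen_eval_ne_zero fun e => ?_
    simpa only [hs_ne] using isOpen_eval_ne_zero (θ e)
  · refine hF.continuous_of_isOpen_eval_ne_zero fun f => ?_
    simpa only [ht_ne] using isOpen_eval_ne_zero (θ.symm f)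

end Localization

section OrthogonalityPreserving

variable {𝕜 V W : Type*} [RCLike 𝕜] [NormedAddCommGroup V] [InnerProductSpace 𝕜 V]
  [NormedAddCommGroup W] [InnerProductSpace 𝕜 W] {T : V →ₗ[𝕜] W}

theorem norm_sq_mul_inner_map_map (hT : ∀ x y, ⟪x, y⟫_𝕜 = 0 → ⟪T x, T y⟫_𝕜 = 0) (x y : V) :
    (‖x‖ : 𝕜) ^ 2 * ⟪T x, T y⟫_𝕜 = ⟪x, y⟫_𝕜 * (‖T x‖ : 𝕜) ^ 2 := by
  have h : ⟪x, (‖x‖ : 𝕜) ^ 2 • y - ⟪x, y⟫_𝕜 • x⟫_𝕜 = 0 := by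
    rw [inner_sub_right, inner_smul_right, inner_smul_right, inner_self_eq_norm_sq_to_K, mul_comm,
      sub_self]
  simpa [inner_sub_right, inner_smul_right, inner_self_eq_norm_sq_to_K, sub_eq_zero]
    using hT _ _ h

theorem norm_map_mul_norm_of_inner_ne_zero (hT : ∀ x y, ⟪x, y⟫_𝕜 = 0 → ⟪T x, T y⟫_𝕜 = 0)
    {x y : V} (hxy : ⟪x, y⟫_𝕜 ≠ 0) : ‖T x‖ * ‖y‖ = ‖T y‖ * ‖x‖ := by
  have hx := norm_sq_mul_inner_map_map hT x y
  have hy := congrArg (starRingEnd 𝕜) (norm_sq_mul_inner_map_map hT y x)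
  simp only [map_mul, map_pow, RCLike.conj_ofReal, inner_conj_symm] at hy
  have hsq : (‖T x‖ * ‖y‖) ^ 2 = (‖T y‖ * ‖x‖) ^ 2 := by
    rw [← RCLike.ofReal_inj (K := 𝕜)]
    push_cast
    refine mul_left_cancel₀ hxy ?_
    linear_combination (‖x‖ : 𝕜) ^ 2 * hy - (‖y‖ : 𝕜) ^ 2 * hx
  exact (sq_eq_sq₀ (by positivity) (by positivity)).1 hsq

theorem norm_map_mul_norm (hT : ∀ x y, ⟪x, y⟫_𝕜 = 0 → ⟪T x, T y⟫_𝕜 = 0) (x y : V) :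
    ‖T x‖ * ‖y‖ = ‖T y‖ * ‖x‖ := by
  rcases eq_or_ne x 0 with rfl | hx
  · simp
  rcases eq_or_ne y 0 with rfl | hy
  · simp
  by_cases hxy : ⟪x, y⟫_𝕜 = 0
  · have hxz : ⟪x, x + y⟫_𝕜 ≠ 0 := by simpa [inner_add_right, hxy] using hx
    have hyz : ⟪y, x + y⟫_𝕜 ≠ 0 := by
      simpa [inner_add_right, inner_eq_zero_symm.1 hxy] using hy
    have hz : ‖x + y‖ ≠ 0 := fun h => hxz (by rw [norm_eq_zero.1 h, inner_zero_right])
    refine mul_left_cancel₀ hz ?_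
    linear_combination ‖y‖ * norm_map_mul_norm_of_inner_ne_zero hT hxz -
      ‖x‖ * norm_map_mul_norm_of_inner_ne_zero hT hyz
  · exact norm_map_mul_norm_of_inner_ne_zero hT hxy

theorem exists_eq_smul_linearIsometryEquiv [Nontrivial W]
    (hT : ∀ x y, ⟪x, y⟫_𝕜 = 0 → ⟪T x, T y⟫_𝕜 = 0) (hsurj : Function.Surjective T) :
    ∃ (c : ℝ) (J : V ≃ₗᵢ[𝕜] W), 0 < c ∧ ∀ x, T x = (c : 𝕜) • J x := by
  obtain ⟨w, hw⟩ := exists_ne (0 : W)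
  obtain ⟨x₀, rfl⟩ := hsurj w
  have hx₀ : 0 < ‖x₀‖ := norm_pos_iff.2 fun h => hw (by rw [h, map_zero])
  set c := ‖T x₀‖ / ‖x₀‖
  have hc : 0 < c := div_pos (norm_pos_iff.2 hw) hx₀
  have hc𝕜 : (c : 𝕜) ≠ 0 := RCLike.ofReal_ne_zero.2 hc.ne'
  have hnorm (x : V) : ‖T x‖ = c * ‖x‖ := by
    rw [div_mul_eq_mul_div, norm_map_mul_norm hT x₀ x, mul_div_cancel_right₀ _ hx₀.ne']
  let J₀ : V →ₗᵢ[𝕜] W := ⟨(c : 𝕜)⁻¹ • T, fun x => by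
    rw [LinearMap.smul_apply, norm_smul, norm_inv, RCLike.norm_ofReal, abs_of_pos hc, hnorm,
      inv_mul_cancel_left₀ hc.ne']⟩
  have hJ₀ (x : V) : (c : 𝕜) • J₀ x = T x := smul_inv_smul₀ hc𝕜 (T x)
  have hJ₀_surj : Function.Surjective J₀ := fun v => by
    obtain ⟨x, hx⟩ := hsurj ((c : 𝕜) • v)
    exact ⟨x, smul_right_injective W hc𝕜 ((hJ₀ x).trans hx)⟩
  exact ⟨c, .ofSurjective J₀ hJ₀_surj, hc, fun x => (hJ₀ x).symm⟩

end OrthogonalityPreserving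

section FibreMap

variable {Ω : Type*} [TopologicalSpace Ω]
  {E : Type*} [NormedAddCommGroup E] [NormedSpace ℂ E] [SMul C₀(Ω, ℂ) E] [CStarModule C₀(Ω, ℂ) E]
  {Δ : Type*} [TopologicalSpace Δ]
  {F : Type*} [NormedAddCommGroup F] [NormedSpace ℂ F] [SMul C₀(Δ, ℂ) F] [CStarModule C₀(Δ, ℂ) F]

theorem IsLocalizedAt.exists_fibreMap {θ : E →ₗ[ℂ] F} {ω : Ω} {ν : Δ}
    (h : IsLocalizedAt θ ω ν) :
    ∃ T : Fibre E ω →ₗ[ℂ] Fibre F ν, ∀ e, T (eval ω e) = eval ν (θ e) :=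
  ⟨(vanishing E ω).liftQ ((evalCLM F ν : F →ₗ[ℂ] Fibre F ν) ∘ₗ θ) fun e he =>
    h e ((Submodule.Quotient.mk_eq_zero _).2 he), fun _ => rfl⟩

theorem IsLocalizedAt.inner_eval_map_eq_zero {θ : E →ₗ[ℂ] F} {ω : Ω} {ν : Δ}
    (h : IsLocalizedAt θ ω ν) (hop : IsOrthogonalityPreserving Ω Δ θ) {e g : E}
    (heg : ⟪eval ω e, eval ω g⟫_ℂ = 0) : ⟪eval ν (θ e), eval ν (θ g)⟫_ℂ = 0 := by
  rcases eq_or_ne (eval ω e) 0 with he | he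
  · rw [h e he, inner_zero_left]
  set p := ⟪e, e⟫_C₀(Ω, ℂ)
  set q := ⟪e, g⟫_C₀(Ω, ℂ)
  have hp : p ω ≠ 0 := by rwa [← inner_eval_eval, inner_self_ne_zero]
  have horth : ⟪e, p • g - q • e⟫_C₀(Ω, ℂ) = 0 := by
    rw [CStarModule.inner_sub_right, CStarModule.inner_op_smul_right,
      CStarModule.inner_op_smul_right, mul_comm, sub_self]
  have heval : eval ω (p • g - q • e - p ω • g) = 0 := by
    simp [show q ω = 0 from heg]
  have hmap : eval ν (θ (p • g - q • e)) = p ω • eval ν (θ g) := by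
    rw [← sub_eq_zero, ← eval_smul, ← eval_sub, ← map_smul, ← map_sub]
    exact h _ heval
  have hinner : ⟪eval ν (θ e), eval ν (θ (p • g - q • e))⟫_ℂ = 0 :=
    inner_eq_zero_iff.1 (hop _ _ horth) ν
  rw [hmap, inner_smul_right] at hinner
  exact (mul_eq_zero.1 hinner).resolve_left hp

theorem IsLocalizedAt.exists_linearIsometryEquiv [LocallyCompactSpace Δ] [T2Space Δ]
    (hF : IsFull Δ F) {θ : E →ₗ[ℂ] F} (hθ : Function.Surjective θ) {ω : Ω} {ν : Δ}
    (h : IsLocalizedAt θ ω ν) (hop : IsOrthogonalityPreserving Ω Δ θ) :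
    ∃ (c : ℝ) (J : Fibre E ω ≃ₗᵢ[ℂ] Fibre F ν), 0 < c ∧
      ∀ e : E, eval ν (θ e) = (c : ℂ) • J (eval ω e) := by
  obtain ⟨T, hT⟩ := h.exists_fibreMap
  have hTop (u v : Fibre E ω) (huv : ⟪u, v⟫_ℂ = 0) : ⟪T u, T v⟫_ℂ = 0 := by
    obtain ⟨e, rfl⟩ := eval_surjective ω u
    obtain ⟨g, rfl⟩ := eval_surjective ω v
    rw [hT, hT]
    exact h.inner_eval_map_eq_zero hop huv
  have hTsurj : Function.Surjective T := by
    refine Function.Surjective.of_comp (g := eval ω) ?_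
    exact (funext hT : T ∘ eval ω = eval ν ∘ θ) ▸ (eval_surjective ν).comp hθ
  obtain ⟨f, hf⟩ := hF.exists_eval_ne_zero ν
  have : Nontrivial (Fibre F ν) := ⟨⟨_, _, hf⟩⟩
  obtain ⟨c, J, hc, hJ⟩ := exists_eq_smul_linearIsometryEquiv hTop hTsurj
  exact ⟨c, J, hc, fun e => (hT e).symm.trans (hJ _)⟩

end FibreMap

section Continuity

variable {Ω : Type*} [TopologicalSpace Ω]
  {E : Type*} [NormedAddCommGroup E] [NormedSpace ℂ E] [SMul C₀(Ω, ℂ) E] [CStarModule C₀(Ω, ℂ) E]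
  {Δ : Type*} [TopologicalSpace Δ]
  {F : Type*} [NormedAddCommGroup F] [NormedSpace ℂ F] [SMul C₀(Δ, ℂ) F] [CStarModule C₀(Δ, ℂ) F]

variable (Δ) in
theorem continuous_of_forall_continuous_eval {B : Type*} [NormedAddCommGroup B] [NormedSpace ℂ B]
    [CompleteSpace B] [CompleteSpace F] (θ : B →ₗ[ℂ] F)
    (h : ∀ ν : Δ, Continuous fun e => eval ν (θ e)) : Continuous θ := by
  refine θ.continuous_of_seq_closed_graph fun u x y hu hy => ext_eval Δ fun ν => ?_
  exact tendsto_nhds_unique (((evalCLM F ν).continuous.tendsto y).comp hy)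
    (((h ν).tendsto x).comp hu)

theorem continuous_mk_smul_eval {φ : Δ → ℂ} (hφ : Continuous φ) (f : F) :
    Continuous fun ν : Δ => (⟨ν, φ ν • eval ν f⟩ : HilbertBundle Δ F) := by
  refine continuous_generateFrom_iff.2 ?_
  rintro _ ⟨U, g, ε, hU, rfl⟩
  have hsq (ν : Δ) : ‖φ ν • eval ν f - eval ν g‖ ^ 2 = (‖φ ν‖ * ‖eval ν f‖) ^ 2 -
      2 * (star (φ ν) * ⟪f, g⟫_C₀(Δ, ℂ) ν).re + ‖eval ν g‖ ^ 2 := by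
    rw [norm_sub_sq (𝕜 := ℂ), inner_smul_left, norm_smul, inner_eval_eval]
    rfl
  have hnorm : Continuous fun ν => ‖φ ν • eval ν f - eval ν g‖ := by
    have hf := continuous_norm_eval (Ω := Δ) f
    have hg := continuous_norm_eval (Ω := Δ) g
    refine Continuous.congr ?_ fun ν => Real.sqrt_sq (norm_nonneg (φ ν • eval ν f - eval ν g))
    simp only [hsq]
    fun_prop
  exact hU.inter (isOpen_lt hnorm continuous_const)

variable [LocallyCompactSpace Ω] [T2Space Ω]

theorem IsFull.continuous_of_norm_eval_map_eq (hE : IsFull Ω E) {θ : E → F} {s : Δ → Ω}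
    (hs : Continuous s) {c : Δ → ℝ} (h : ∀ e ν, ‖eval ν (θ e)‖ = c ν * ‖eval (s ν) e‖) :
    Continuous c := by
  refine continuous_iff_continuousAt.2 fun ν => ?_
  obtain ⟨x, hx⟩ := hE.exists_eval_ne_zero (s ν)
  have hxs : ContinuousAt (fun ν => ‖eval (s ν) x‖) ν :=
    ((continuous_norm_eval x).comp hs).continuousAt
  refine ((continuous_norm_eval (θ x)).continuousAt.div hxs (norm_ne_zero_iff.2 hx)).congr ?_
  filter_upwards [hxs.eventually_ne (norm_ne_zero_iff.2 hx)] with ν' hν'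
  rw [Pi.div_apply, h, mul_div_cancel_right₀ _ hν']

theorem IsFull.le_opNorm_of_norm_eval_map_eq (hE : IsFull Ω E) {θ : E →L[ℂ] F} {ω : Ω} {ν : Δ}
    {c : ℝ} (h : ∀ e, ‖eval ν (θ e)‖ = c * ‖eval ω e‖) : c ≤ ‖θ‖ := by
  obtain ⟨x, hxω, hx, -⟩ := hE.exists_norm_eval_eq_one isOpen_univ (Set.mem_univ ω)
  calc c = ‖eval ν (θ x)‖ := by rw [h, hxω, mul_one]
    _ ≤ ‖θ x‖ := norm_eval_le ν _
    _ ≤ ‖θ‖ := θ.unit_le_opNorm x hx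

end Continuity

end HilbertC0Module

end

open HilbertC0Module

theorem theorem3p12
    {Ω Δ : Type*} [TopologicalSpace Ω] [LocallyCompactSpace Ω] [T2Space Ω]
    [TopologicalSpace Δ] [LocallyCompactSpace Δ] [T2Space Δ]
    {E : Type*} [NormedAddCommGroup E] [NormedSpace ℂ E] [CompleteSpace E]
    [SMul C₀(Ω, ℂ) E] [CStarModule C₀(Ω, ℂ) E]
    {F : Type*} [NormedAddCommGroup F] [NormedSpace ℂ F] [CompleteSpace F]
    [SMul C₀(Δ, ℂ) F] [CStarModule C₀(Δ, ℂ) F]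
    (hE : HilbertC0Module.IsFull Ω E) (hF : HilbertC0Module.IsFull Δ F)
    (θ : E ≃ₗ[ℂ] F)
    (hql : HilbertC0Module.IsQuasiLocal Ω Δ θ)
    (hql' : HilbertC0Module.IsQuasiLocal Δ Ω θ.symm)
    (hop : HilbertC0Module.IsOrthogonalityPreserving Ω Δ (θ : E →ₗ[ℂ] F))
    (hop' : HilbertC0Module.IsOrthogonalityPreserving Δ Ω (θ.symm : F →ₗ[ℂ] E)) :
    (∃ C : ℝ, ∀ e : E, ‖θ e‖ ≤ C * ‖e‖) ∧
    ∃ (σ : Δ ≃ₜ Ω) (ψ : BoundedContinuousFunction Δ ℝ)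
      (J : ∀ ν : Δ, HilbertC0Module.Fibre E (σ ν) ≃ₗᵢ[ℂ] HilbertC0Module.Fibre F ν),
      (∀ ν, 0 < ψ ν) ∧
      (∀ (e : E) (ν : Δ), HilbertC0Module.eval ν (θ e) =
        (ψ ν : ℂ) • J ν (HilbertC0Module.eval (σ ν) e)) ∧
      ∀ f : E, Continuous fun ν : Δ =>
        (⟨ν, J ν (HilbertC0Module.eval (σ ν) f)⟩ : HilbertC0Module.HilbertBundle Δ F) := by
  have hθ : IsBiseparating Ω Δ θ := ⟨hql.isSeparating hop hop', hql'.isSeparating hop' hop⟩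
  obtain ⟨σ, hσ⟩ := hθ.exists_homeomorph hE hF
  choose c J hc hJ using fun ν =>
    IsLocalizedAt.exists_linearIsometryEquiv hF (θ := (θ : E →ₗ[ℂ] F)) θ.surjective (hσ ν) hop
  have hnorm (e : E) (ν : Δ) : ‖eval ν (θ e)‖ = c ν * ‖eval (σ ν) e‖ := by
    rw [← θ.coe_coe, hJ, norm_smul, Complex.norm_real, Real.norm_of_nonneg (hc ν).le,
      LinearIsometryEquiv.norm_map]
  have hθ_cont : Continuous (θ : E →ₗ[ℂ] F) := by
    refine continuous_of_forall_continuous_eval Δ _ fun ν => ?_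
    simp only [hJ]
    exact ((J ν).continuous.comp (evalCLM E (σ ν)).continuous).const_smul (c ν : ℂ)
  let Θ : E →L[ℂ] F := ⟨θ, hθ_cont⟩
  have hc_cont : Continuous c := hE.continuous_of_norm_eval_map_eq σ.continuous hnorm
  have hc_le (ν : Δ) : ‖c ν‖ ≤ ‖Θ‖ := (Real.norm_of_nonneg (hc ν).le).trans_le <|
    hE.le_opNorm_of_norm_eval_map_eq (θ := Θ) fun e => hnorm e ν
  refine ⟨⟨‖Θ‖, Θ.le_opNorm⟩, σ, .ofNormedAddCommGroup c hc_cont _ hc_le, J, hc,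
    fun e ν => hJ ν e, fun f => ?_⟩
  have hc_ne (ν : Δ) : (c ν : ℂ) ≠ 0 := Complex.ofReal_ne_zero.2 (hc ν).ne'
  have hinv (ν : Δ) : J ν (eval (σ ν) f) = (c ν : ℂ)⁻¹ • eval ν (θ f) := by
    rw [← θ.coe_coe, hJ, inv_smul_smul₀ (hc_ne ν)]
  simp only [hinv]
  exact continuous_mk_smul_eval ((Complex.continuous_ofReal.comp hc_cont).inv₀ hc_ne) (θ f)
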